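/- Let $d \ge 2$ be even and let $n \ge 0$ be an integer. For a $d$-way hypermatrix $X = (X_{p_1,\ldots,p_d})$ with entries in $\mathbb{C}$ and all modes indexed by a finite set $P$ with $N$ elements (that is, a tensor in $(\mathbb{C}^{N})^{\otimes d}$ written in the standard basis), let $$\mathrm{det}_d(X) = \frac{1}{N!}\sum_{\sigma_1,\ldots,\sigma_d \in S_P} \mathrm{sgn}(\sigma_1)\cdots\mathrm{sgn}(\sigma_d)\prod_{p \in P} X_{\sigma_1(p),\ldots,\sigma_d(p)}$$ be its combinatorial hyperdeterminant, where $S_P$ is the group of permutations of $P$. Let $\mathsf{M}_n^{(d)} \in (\mathbb{C}^{n^2})^{\otimes d}$ be the $d$-iterated matrix multiplication tensor, i.e. the hypermatrix with modes indexed by $P = \{1,\ldots,n\}^2$ and entries $$(\mathsf{M}_n^{(d)})_{(i_1,j_1),\ldots,(i_d,j_d)} = \delta_{j_1 = i_2}\,\delta_{j_2 = i_3}\cdots\delta_{j_{d-1} = i_d}\,\delta_{i_1 = j_d}.$$ Then $$\mathrm{det}_d(\mathsf{M}_n^{(d)}) = \pm\left(\prod_{i=0}^{n-1}\frac{(n+i)!}{i!}\right)^{\frac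 d2 - 1}.$$ Moreover $\prod_{i=0}^{n-1}\frac{(n+i)!}{i!} = h_{n\times n}$, the product of the hook lengths of all cells of the $n \times n$ square Young diagram, so that $\mathrm{det}_d(\mathsf{M}_n^{(d)}) = \pm h_{n\times n}^{d/2-1}$. In particular, $\mathrm{det}_d(\mathsf{M}_n^{(d)}) \neq 0$. -/

import Mathlib

open scoped Nat

/-- A `d`-way hypermatrix with all modes indexed by `ι`: the coordinates, in the standard basis
of each mode, of a tensor in `(ℂ^ι)^{⊗ d}`. -/
abbrev Hypermatrix (d : ℕ) (ι : Type*) : Type _ := (Fin d → ι) → ℂ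

/-- Cayley's combinatorial hyperdeterminant
`det_d(X) = (1 / N!) ∑_{σ₁, …, σ_d ∈ S_N} sgn(σ₁) ⋯ sgn(σ_d) ∏_i X_{σ₁(i), …, σ_d(i)}`,
with `N = |ι|` and permutations of the index set `ι`. -/
noncomputable def hyperdet {d : ℕ} {ι : Type*} [Fintype ι] [DecidableEq ι]
    (X : Hypermatrix d ι) : ℂ :=
  (1 / ((Fintype.card ι)! : ℂ)) *
    ∑ σ : Fin d → Equiv.Perm ι,
      (∏ k : Fin d, ((Equiv.Perm.sign (σ k) : ℤ) : ℂ)) * ∏ i : ι, X (fun k => σ k i)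

/-- The shifted `d`-iterated matrix multiplication tensor `M_X^{(d)}`: its entry at
`((i₁, j₁), …, (i_d, j_d))` is `δ_{j₁ = i₂} δ_{j₂ = i₃} ⋯ δ_{j_{d-1} = i_d} X_{i₁ j_d}`. -/
noncomputable def shiftedMatMulTensor (d : ℕ) (hd : 0 < d) {n : ℕ}
    (X : Matrix (Fin n) (Fin n) ℂ) : Hypermatrix d (Fin n × Fin n) :=
  fun p =>
    (∏ k : Fin (d - 1),
      if (p ⟨k, by omega⟩).2 = (p ⟨k + 1, by omega⟩).1 then (1 : ℂ) else 0) *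
    X (p ⟨0, hd⟩).1 (p ⟨d - 1, by omega⟩).2

/-- The `d`-iterated matrix multiplication tensor `M_n^{(d)} = M_{Id_n}^{(d)}`. -/
noncomputable def matMulTensor (d : ℕ) (hd : 0 < d) (n : ℕ) :
    Hypermatrix d (Fin n × Fin n) :=
  shiftedMatMulTensor d hd (1 : Matrix (Fin n) (Fin n) ℂ)

/-- The `n × n` square Young diagram. -/
def squareDiagram (n : ℕ) : YoungDiagram where
  cells := Finset.range n ×ˢ Finset.range n
  isLowerSet := by
    rintro ⟨a, b⟩ ⟨c, e⟩ h hab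
    simp only [Finset.coe_product, Set.mem_prod, Finset.mem_coe, Finset.mem_range] at hab ⊢
    have h1 : c ≤ a := h.1
    have h2 : e ≤ b := h.2
    omega

/-- The hook length of `c` in `lam`: the number of cells weakly to the right of `c` in its row or
weakly below `c` in its column (`c` itself counted once). -/
def hookLength (lam : YoungDiagram) (c : ℕ × ℕ) : ℕ :=
  (lam.cells.filter fun e => (e.1 = c.1 ∧ c.2 ≤ e.2) ∨ (e.2 = c.2 ∧ c.1 ≤ e.1)).card

/-- The product `h_lam` of all hook lengths of `lam`. -/
def hookProduct (lam : YoungDiagram) : ℕ :=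
  ∏ c ∈ lam.cells, hookLength lam c

/-! Write `T` for `transferMatrix n` and `N = n ^ 2`. The Kronecker deltas glue the second
components of each permutation to the first components of the next, cyclically, so the
hyperdeterminant is `tr (T ^ d) / N!`.

Swapping coordinates makes `T` symmetric up to the sign `ε = swapSign n`, so `T ^ 2 = ε T Tᵀ`. By
the symmetric Leibniz formula for the block diagonal matrix of `n` copies of `Z`, the generating
polynomial `∑ T ^ 2 (a, b) ∏ Z (a p, b p)` equals `ε N! det Z ^ n`. Hence the entries of `T ^ 2`
are, up to `ε`, apolar pairings of monomials with `det ^ n`.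

This gives a recursion: if the generating polynomial of `T ^ (2t+2)` is `c det ^ n`, evaluate it at
`Y Zᵀ` and pair with `det Z ^ n` in the variables `Z`. The left side becomes `ε` times the
generating polynomial of `T ^ (2t+4)` at `Y`, and the right side gains the square norm of `det ^ n`.
Setting `Y = 1` recovers the trace.

The square norm follows from the Cayley identity, because multiplication by a variable is adjoint to
differentiation. It is a product of rising factorials, which is also the hook product of the square.
-/

/-! ### Antisymmetrized derivations of powers of a determinant. -/

/-- The Leibniz rule for finite products. -/
theorem Derivation.leibniz_finset_prod {k R ι : Type*} [CommRing k] [CommRing R]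
    [Algebra k R] [DecidableEq ι] (δ : Derivation k R R) (s : Finset ι) (f : ι → R) :
    δ (∏ b ∈ s, f b) = ∑ a ∈ s, δ (f a) * ∏ b ∈ s.erase a, f b := by
  induction s using Finset.induction_on with
  | empty => simp
  | insert a s ha ih =>
    rw [Finset.prod_insert ha, Derivation.leibniz, ih, Finset.sum_insert ha,
      Finset.erase_insert ha, smul_eq_mul, smul_eq_mul, Finset.mul_sum, add_comm, mul_comm]
    congr 1
    refine Finset.sum_congr rfl fun b hb => ?_
    have hab : a ≠ b := fun h => ha (h ▸ hb)
    rw [Finset.erase_insert_of_ne hab, Finset.prod_insert (by simp [ha])]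
    ring

/-- The composite `∂ (i 0) (j 0) ∘ ⋯ ∘ ∂ (i (k - 1)) (j (k - 1))`. -/
def iteratedDerivation {k R m : Type*} [CommRing k] [CommRing R] [Algebra k R]
    (D : m → m → Derivation k R R) : ∀ {l : ℕ}, (Fin l → m) → (Fin l → m) → R → R
  | 0, _, _, r => r
  | _ + 1, i, j, r => D (i 0) (j 0) (iteratedDerivation D (Fin.tail i) (Fin.tail j) r)

/-- An antisymmetrized sum only depends on the antisymmetrization of its last `k` arguments. -/
theorem sum_perm_succ_congr {R m : Type*} [CommRing R] {k : ℕ} (δ : m → R →+ R)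
    (H H' : (Fin k → m) → R)
    (h : ∀ J : Fin k → m, ∑ e : Equiv.Perm (Fin k), ((Equiv.Perm.sign e : ℤ) : R) * H (J ∘ e) =
      ∑ e : Equiv.Perm (Fin k), ((Equiv.Perm.sign e : ℤ) : R) * H' (J ∘ e))
    (j : Fin (k + 1) → m) :
    ∑ e : Equiv.Perm (Fin (k + 1)),
        ((Equiv.Perm.sign e : ℤ) : R) * δ (j (e 0)) (H (Fin.tail (j ∘ e))) =
      ∑ e : Equiv.Perm (Fin (k + 1)),
        ((Equiv.Perm.sign e : ℤ) : R) * δ (j (e 0)) (H' (Fin.tail (j ∘ e))) := by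
  have key : ∀ F : (Fin k → m) → R, ∑ e : Equiv.Perm (Fin (k + 1)),
        ((Equiv.Perm.sign e : ℤ) : R) * δ (j (e 0)) (F (Fin.tail (j ∘ e))) =
      ∑ p : Fin (k + 1), (if p = 0 then 1 else -1) *
        δ (j p) (∑ e : Equiv.Perm (Fin k), ((Equiv.Perm.sign e : ℤ) : R) *
          F ((Fin.tail (j ∘ Equiv.swap 0 p)) ∘ e)) := by
    intro F
    -- A permutation is split into its value `p` at `0` and a permutation of the rest; the
    -- transposition `swap 0 p` contributes the sign.
    rw [← Equiv.sum_comp Equiv.Perm.decomposeFin.symm, Fintype.sum_prod_type]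
    refine Finset.sum_congr rfl fun p _ => ?_
    rw [map_sum, Finset.mul_sum]
    refine Finset.sum_congr rfl fun e _ => ?_
    have h1 : Fin.tail (j ∘ Equiv.Perm.decomposeFin.symm (p, e)) =
        (Fin.tail (j ∘ Equiv.swap 0 p)) ∘ e := by
      ext x; simp [Fin.tail]
    rw [h1, Equiv.Perm.decomposeFin_symm_apply_zero, Equiv.Perm.decomposeFin.symm_sign,
      ← zsmul_eq_mul, ← zsmul_eq_mul, map_zsmul, zsmul_eq_mul, zsmul_eq_mul]
    split_ifs <;> push_cast <;> ring
  rw [key, key]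
  refine Finset.sum_congr rfl fun p _ => ?_
  rw [h]

/-- The Cayley identity for minors, in terms of commuting symbols `D` (the determinant) and `G`
(the inverse matrix). -/
theorem cayley_minor {K R m : Type*} [CommRing K] [CommRing R] [Algebra K R]
    (δ : m → m → Derivation K R R) (D : R) (G : Matrix m m R) (hD : ∀ i j, δ i j D = D * G j i)
    (hG : ∀ i j k l, δ i j (G k l) = -(G k i * G j l)) (s k : ℕ) (i j : Fin k → m) :
    ∑ e : Equiv.Perm (Fin k),
        ((Equiv.Perm.sign e : ℤ) : R) * iteratedDerivation δ i (j ∘ e) (D ^ s) =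
      ∑ e : Equiv.Perm (Fin k), ((Equiv.Perm.sign e : ℤ) : R) *
        ((s.ascFactorial k : R) * (D ^ s * ∏ b, G (j (e b)) (i b))) := by
  induction k with
  | zero => simp [iteratedDerivation]
  | succ k ih =>
    have step := sum_perm_succ_congr (fun q => ((δ (i 0) q : Derivation K R R) : R →+ R))
      (fun J => iteratedDerivation δ (Fin.tail i) J (D ^ s))
      (fun J => (s.ascFactorial k : R) * (D ^ s * ∏ b, G (J b) (Fin.tail i b)))
      (fun J => ih (Fin.tail i) J) j
    refine Eq.trans step ?_
    -- Differentiating `D ^ s` contributes the factor `s`; differentiating the factor of `G` with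
    -- index `a` exchanges its row index with that of the new factor, that is, composes `e` with a
    -- transposition.
    have hW : ∀ e : Equiv.Perm (Fin (k + 1)),
        δ (i 0) (j (e 0)) ((s.ascFactorial k : R) *
          (D ^ s * ∏ b, G (Fin.tail (j ∘ e) b) (Fin.tail i b))) =
        (s.ascFactorial k : R) * D ^ s * ((s : R) * ∏ b, G (j (e b)) (i b)) -
        (s.ascFactorial k : R) * D ^ s * ∑ a : Fin k,
          ∏ b, G (j ((e * Equiv.swap 0 a.succ) b)) (i b) := by
      intro e
      have hpow : δ (i 0) (j (e 0)) (D ^ s) = s * D ^ s * G (j (e 0)) (i 0) := by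
        rw [Derivation.leibniz_pow, hD]
        cases s with
        | zero => simp
        | succ s => simp [pow_succ]; ring
      rw [Derivation.leibniz, Derivation.map_natCast, Derivation.leibniz, hpow,
        Derivation.leibniz_finset_prod, Fin.prod_univ_succ]
      have hsum : ∑ a : Fin k, δ (i 0) (j (e 0)) (G (Fin.tail (j ∘ e) a) (Fin.tail i a)) *
            ∏ b ∈ Finset.univ.erase a, G (Fin.tail (j ∘ e) b) (Fin.tail i b) =
          -∑ a : Fin k, ∏ b, G (j ((e * Equiv.swap 0 a.succ) b)) (i b) := by
        rw [← Finset.sum_neg_distrib]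
        refine Finset.sum_congr rfl fun a _ => ?_
        rw [hG, Fin.prod_univ_succ, ← Finset.mul_prod_erase Finset.univ _ (Finset.mem_univ a)]
        have : ∏ b ∈ Finset.univ.erase a,
              G (j ((e * Equiv.swap 0 a.succ) b.succ)) (i b.succ) =
            ∏ b ∈ Finset.univ.erase a, G (Fin.tail (j ∘ e) b) (Fin.tail i b) := by
          refine Finset.prod_congr rfl fun b hb => ?_
          rw [Equiv.Perm.mul_apply, Equiv.swap_apply_of_ne_of_ne (Fin.succ_ne_zero b)
            (by simpa using Finset.ne_of_mem_erase hb)]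
          rfl
        rw [this]
        simp only [Equiv.Perm.mul_apply, Equiv.swap_apply_left, Equiv.swap_apply_right, Fin.tail,
          Function.comp_apply]
        ring
      rw [hsum]
      simp only [smul_eq_mul, Fin.tail, Function.comp_apply]
      ring
    -- The sign of the transposition cancels the minus sign in `hG`, so each of the `k` exchanges
    -- adds `1` and the total factor is `s + k`.
    have hsw : ∀ a : Fin k, ∑ e : Equiv.Perm (Fin (k + 1)), ((Equiv.Perm.sign e : ℤ) : R) *
          ∏ b, G (j ((e * Equiv.swap 0 a.succ) b)) (i b) =
        -∑ e : Equiv.Perm (Fin (k + 1)), ((Equiv.Perm.sign e : ℤ) : R) *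
          ∏ b, G (j (e b)) (i b) := by
      intro a
      rw [← Equiv.sum_comp (Equiv.mulRight (Equiv.swap 0 a.succ)) fun e =>
        ((Equiv.Perm.sign e : ℤ) : R) * ∏ b, G (j (e b)) (i b), ← Finset.sum_neg_distrib]
      refine Finset.sum_congr rfl fun e _ => ?_
      simp [Equiv.Perm.sign_swap (Fin.succ_ne_zero a).symm]
    have hfin : ∑ e : Equiv.Perm (Fin (k + 1)), ((Equiv.Perm.sign e : ℤ) : R) *
          ((s.ascFactorial k : R) * D ^ s * ((s : R) * ∏ b, G (j (e b)) (i b)) -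
            (s.ascFactorial k : R) * D ^ s * ∑ a : Fin k,
              ∏ b, G (j ((e * Equiv.swap 0 a.succ) b)) (i b)) =
        (s.ascFactorial k : R) * D ^ s * (s * ∑ e : Equiv.Perm (Fin (k + 1)),
            ((Equiv.Perm.sign e : ℤ) : R) * ∏ b, G (j (e b)) (i b)) -
          (s.ascFactorial k : R) * D ^ s * ∑ a : Fin k, ∑ e : Equiv.Perm (Fin (k + 1)),
            ((Equiv.Perm.sign e : ℤ) : R) *
              ∏ b, G (j ((e * Equiv.swap 0 a.succ) b)) (i b) := by
      rw [Finset.sum_comm]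
      simp only [Finset.mul_sum]
      rw [← Finset.sum_sub_distrib]
      refine Finset.sum_congr rfl fun e _ => ?_
      rw [mul_sub, Finset.mul_sum]
      congr 1
      · ring
      · exact Finset.sum_congr rfl fun a _ => by ring
    have hlhs := Finset.sum_congr rfl fun (e : Equiv.Perm (Fin (k + 1))) (_ : e ∈ Finset.univ) =>
      congrArg (((Equiv.Perm.sign e : ℤ) : R) * ·) (hW e)
    refine Eq.trans hlhs (Eq.trans hfin ?_)
    rw [Finset.sum_congr rfl fun a _ => hsw a, Finset.sum_const, Finset.card_univ,
      Fintype.card_fin, Nat.ascFactorial_succ]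
    simp only [Finset.mul_sum, nsmul_eq_mul, mul_neg, sub_neg_eq_add]
    rw [← Finset.sum_add_distrib]
    refine Finset.sum_congr rfl fun e _ => ?_
    push_cast
    ring

/-- A derivation of a domain extends to its fraction field. -/
theorem Derivation.exists_extension_fractionRing {k A K : Type*} [CommRing k] [CommRing A]
    [Algebra k A] [Field K] [Algebra A K] [IsFractionRing A K] [Algebra k K]
    [IsScalarTower k A K] (δ : Derivation k A A) :
    ∃ δ' : Derivation k K K, ∀ a, δ' (algebraMap A K a) = algebraMap A K (δ a) := by
  -- A derivation is a ring map `a ↦ a + δ a · ε` into the dual numbers. It extends to fractions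
  -- because a dual number with invertible first component is a unit.
  let f : A →+* TrivSqZeroExt K K :=
    { toFun := fun a => TrivSqZeroExt.inl (algebraMap A K a) +
        TrivSqZeroExt.inr (algebraMap A K (δ a))
      map_one' := by ext <;> simp
      map_zero' := by ext <;> simp
      map_add' := fun a b => by ext <;> simp [-DualNumber.inr_eq_smul_eps]
      map_mul' := fun a b => by ext <;> simp [-DualNumber.inr_eq_smul_eps, mul_comm] }
  have hf1 : ∀ a, (f a).fst = algebraMap A K a := fun a => by simp [f]
  have hf2 : ∀ a, (f a).snd = algebraMap A K (δ a) := fun a => by simp [f, -DualNumber.inr_eq_smul_eps]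
  have hu : ∀ y : nonZeroDivisors A, IsUnit (f y) := fun y => by
    rw [TrivSqZeroExt.isUnit_iff_isUnit_fst, hf1]
    exact IsLocalization.map_units K y
  let g : K →+* TrivSqZeroExt K K := IsLocalization.lift hu
  have hg : ∀ a, g (algebraMap A K a) = f a := fun a => IsLocalization.lift_eq hu a
  have hfst : ∀ x, (g x).fst = x := by
    have : (TrivSqZeroExt.fstHom K K K).toRingHom.comp g = RingHom.id K := by
      refine IsLocalization.ringHom_ext (nonZeroDivisors A) ?_
      ext a
      simp [hg, hf1]
    exact fun x => congrArg (fun h : K →+* K => h x) this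
  refine ⟨Derivation.mk'
    { toFun := fun x => (g x).snd, map_smul' := ?_, map_add' := by simp } ?_, fun a => ?_⟩
  · intro c x
    rw [Algebra.smul_def, IsScalarTower.algebraMap_apply k A K, map_mul, hg,
      TrivSqZeroExt.snd_mul, hf1, hf2, Derivation.map_algebraMap]
    simp [Algebra.smul_def, IsScalarTower.algebraMap_apply k A K]
  · intro a b
    change (g (a * b)).snd = a • (g b).snd + b • (g a).snd
    rw [map_mul, TrivSqZeroExt.snd_mul, hfst, hfst, op_smul_eq_smul]
  · exact (congrArg TrivSqZeroExt.snd (hg a)).trans (hf2 a)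

theorem map_iteratedDerivation {k A K m : Type*} [CommRing k] [CommRing A] [CommRing K]
    [Algebra k A] [Algebra k K] (ψ : A →+* K)
    (δ : m → m → Derivation k A A) (δ' : m → m → Derivation k K K)
    (h : ∀ i j a, δ' i j (ψ a) = ψ (δ i j a)) {l : ℕ} (i j : Fin l → m) (r : A) :
    ψ (iteratedDerivation δ i j r) = iteratedDerivation δ' i j (ψ r) := by
  induction l with
  | zero => rfl
  | succ l ih => simp only [iteratedDerivation]; rw [← h, ih]

/-- Derivative of a determinant, row by row. -/
theorem Derivation.map_det {k R m : Type*} [CommRing k] [CommRing R] [Algebra k R] [Fintype m] [DecidableEq m]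
    (δ : Derivation k R R) (M : Matrix m m R) :
    δ M.det = ∑ r, (M.updateRow r fun q => δ (M r q)).det := by
  have hdet : ∀ N : Matrix m m R,
      N.det = ∑ e : Equiv.Perm m, ((Equiv.Perm.sign e : ℤ) : R) * ∏ r, N r (e r) := fun N => by
    rw [← Matrix.det_transpose, Matrix.det_apply']; rfl
  simp only [hdet]
  rw [map_sum, Finset.sum_comm]
  refine Finset.sum_congr rfl fun e _ => ?_
  rw [← zsmul_eq_mul, map_zsmul, zsmul_eq_mul, Derivation.leibniz_finset_prod, Finset.mul_sum]
  refine Finset.sum_congr rfl fun r _ => ?_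
  rw [← Finset.mul_prod_erase Finset.univ _ (Finset.mem_univ r)]
  congr 2
  · simp
  · refine Finset.prod_congr rfl fun b hb => ?_
    simp [Matrix.updateRow_ne (Finset.ne_of_mem_erase hb)]

/-! ### The Cayley identity for the generic matrix. -/

section Cayley

variable {m k : Type*} [Fintype m] [DecidableEq m] [CommRing k]

/-- Only row `i` contains the variable `(i, j)`, and differentiating that row turns it into a unit
vector. -/
theorem pderiv_det_mvPolynomialX (i j : m) :
    MvPolynomial.pderiv (i, j) (Matrix.mvPolynomialX m m k).det =
      (Matrix.mvPolynomialX m m k).adjugate j i := by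
  rw [Derivation.map_det, Finset.sum_eq_single i, Matrix.adjugate_apply]
  · congr 2
    ext1 q
    rcases eq_or_ne q j with rfl | h
    · simp
    · simp [h, MvPolynomial.pderiv_X]
  · intro r _ hr
    refine Matrix.det_eq_zero_of_row_eq_zero r fun q => ?_
    simp [MvPolynomial.pderiv_X, hr]
  · simp

/-- The Cayley identity. -/
theorem cayley_identity [IsDomain k] (n s : ℕ) :
    ∑ e : Equiv.Perm (Fin n), ((Equiv.Perm.sign e : ℤ) : MvPolynomial (Fin n × Fin n) k) *
      iteratedDerivation (fun i j => MvPolynomial.pderiv (R := k) (i, j)) id e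
        ((Matrix.mvPolynomialX (Fin n) (Fin n) k).det ^ (s + 1)) =
      ((s + 1).ascFactorial n : MvPolynomial (Fin n × Fin n) k) *
        (Matrix.mvPolynomialX (Fin n) (Fin n) k).det ^ s := by
  set A := MvPolynomial (Fin n × Fin n) k
  set K := FractionRing A
  set X : Matrix (Fin n) (Fin n) A := Matrix.mvPolynomialX (Fin n) (Fin n) k with hX
  set Y : Matrix (Fin n) (Fin n) K := X.map (algebraMap A K) with hY
  have hdet : algebraMap A K X.det = Y.det := RingHom.map_det _ _
  have hinj : Function.Injective (algebraMap A K) := IsFractionRing.injective A K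
  have hY0 : Y.det ≠ 0 := by
    rw [← hdet]
    exact fun h => Matrix.det_mvPolynomialX_ne_zero (Fin n) k (hinj (by simpa using h))
  have hunit : IsUnit Y.det := isUnit_iff_ne_zero.mpr hY0
  -- The inverse of the generic matrix exists only over the fraction field, so the partial
  -- derivatives are extended there.
  choose δ hδ using fun i j : Fin n =>
    Derivation.exists_extension_fractionRing (k := k) (K := K) (MvPolynomial.pderiv (R := k) (i, j))
  have hD : ∀ i j, δ i j Y.det = Y.det * Y⁻¹ j i := by
    intro i j
    rw [← hdet, hδ, pderiv_det_mvPolynomialX, hdet, Matrix.inv_def, Matrix.smul_apply, smul_eq_mul,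
      Ring.inverse_eq_inv', mul_inv_cancel_left₀ hY0]
    have := RingHom.map_adjugate (algebraMap A K) X
    exact congrFun (congrFun this j) i
  have hG : ∀ i j a b, δ i j (Y⁻¹ a b) = -(Y⁻¹ a i * Y⁻¹ j b) := by
    intro i j
    -- This differentiates `Y⁻¹ * Y = 1`.
    have h1 : (Y⁻¹).map (δ i j) * Y + Y⁻¹ * Y.map (δ i j) = 0 := by
      ext a b
      have := congrArg (fun M : Matrix _ _ K => δ i j (M a b)) (Matrix.nonsing_inv_mul Y hunit)
      have h0 : δ i j ((1 : Matrix (Fin n) (Fin n) K) a b) = 0 := by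
        rw [Matrix.one_apply]; split_ifs <;> simp
      simp only [h0, Matrix.mul_apply, map_sum, Derivation.leibniz, smul_eq_mul,
        Finset.sum_add_distrib] at this
      simp only [Matrix.add_apply, Matrix.mul_apply, Matrix.map_apply, Matrix.zero_apply]
      rw [← this, add_comm]
      simp only [mul_comm]
    have h2 : Y.map (δ i j) = Matrix.single i j 1 := by
      ext a b
      rw [Matrix.map_apply, hY, Matrix.map_apply, hδ, hX, Matrix.mvPolynomialX_apply,
        Matrix.single_apply]
      by_cases h : i = a ∧ j = b
      · rw [if_pos h, ← h.1, ← h.2]; simp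
      · rw [if_neg h]
        have : (a, b) ≠ (i, j) := fun e => h ⟨congrArg Prod.fst e.symm, congrArg Prod.snd e.symm⟩
        simp [MvPolynomial.pderiv_X_of_ne this]
    have h3 : (Y⁻¹).map (δ i j) = -(Y⁻¹ * Matrix.single i j 1 * Y⁻¹) := by
      have := congrArg (· * Y⁻¹) (eq_neg_of_add_eq_zero_left h1)
      simpa [Matrix.mul_assoc, Matrix.mul_nonsing_inv _ hunit, h2] using this
    intro a b
    have := congrFun (congrFun h3 a) b
    simpa [Matrix.mul_apply, Matrix.single_apply, ite_and, Finset.sum_ite_eq] using this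
  apply hinj
  have key := cayley_minor δ Y.det Y⁻¹ hD hG (s + 1) n id id
  -- For `k = n` the minor is the whole determinant of `Y⁻¹`, which lowers the exponent from `s + 1`
  -- to `s`.
  have hdG : ∑ e : Equiv.Perm (Fin n), ((Equiv.Perm.sign e : ℤ) : K) *
      ∏ b, Y⁻¹ (e b) b = (Y.det)⁻¹ := by
    rw [← Matrix.det_apply', Matrix.det_nonsing_inv, Ring.inverse_eq_inv']
  rw [map_sum, map_mul, map_natCast, map_pow, hdet]
  calc _ = ∑ e : Equiv.Perm (Fin n), ((Equiv.Perm.sign e : ℤ) : K) *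
        iteratedDerivation δ id (id ∘ e) (Y.det ^ (s + 1)) := by
        refine Finset.sum_congr rfl fun e _ => ?_
        rw [map_mul, map_intCast, map_iteratedDerivation _ _ δ hδ, map_pow, hdet]; rfl
    _ = _ := by
        rw [key]
        have : ∀ e : Equiv.Perm (Fin n), ((Equiv.Perm.sign e : ℤ) : K) *
            (((s + 1).ascFactorial n : K) * (Y.det ^ (s + 1) * ∏ b, Y⁻¹ (id (e b)) (id b))) =
            ((s + 1).ascFactorial n : K) * Y.det ^ (s + 1) * (((Equiv.Perm.sign e : ℤ) : K) *
              ∏ b, Y⁻¹ (e b) b) := fun e => by simp only [id]; ring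
        rw [Finset.sum_congr rfl fun e _ => this e, ← Finset.mul_sum, hdG, pow_succ, mul_assoc,
          mul_assoc, mul_inv_cancel₀ hY0, mul_one]

end Cayley

/-! ### The apolar pairing and the norm of powers of the determinant. -/

section Apolar

variable {k σ : Type*} [CommRing k] [Fintype σ]

/-- The apolar pairing of polynomials: distinct monomials are orthogonal, and the square norm of
`X ^ m` is `∏ i, (m i)!`. -/
noncomputable def apolar (k σ : Type*) [CommRing k] [Fintype σ] :
    MvPolynomial σ k →ₗ[k] MvPolynomial σ k →ₗ[k] k :=
  ((MvPolynomial.basisMonomials σ k).constr k).toLinearMap ∘ₗ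
    LinearMap.pi fun m => (∏ i, ((m i)! : k)) • MvPolynomial.lcoeff k m

theorem apolar_monomial (Q : MvPolynomial σ k) (m : σ →₀ ℕ) :
    apolar k σ Q (MvPolynomial.monomial m 1) = (∏ i, ((m i)! : k)) * MvPolynomial.coeff m Q := by
  have h : MvPolynomial.monomial m (1 : k) = MvPolynomial.basisMonomials σ k m := by simp
  rw [apolar, LinearMap.comp_apply, h]
  erw [Module.Basis.constr_basis]
  simp

/-- Tested on a monomial `P`, both sides get the same new factor `m i + 1`: on the left from the
factorial, on the right from the derivative. -/
theorem apolar_X_mul [DecidableEq σ] (Q P : MvPolynomial σ k) (i : σ) :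
    apolar k σ Q (MvPolynomial.X i * P) = apolar k σ (MvPolynomial.pderiv i Q) P := by
  have : apolar k σ Q ∘ₗ LinearMap.mulLeft k (MvPolynomial.X i) =
      apolar k σ (MvPolynomial.pderiv i Q) := by
    refine (MvPolynomial.basisMonomials σ k).ext fun m => ?_
    rw [MvPolynomial.coe_basisMonomials, LinearMap.comp_apply, LinearMap.mulLeft_apply,
      MvPolynomial.X, MvPolynomial.monomial_mul, one_mul, apolar_monomial, apolar_monomial]
    rw [MvPolynomial.coeff_pderiv, add_comm m,
      ← Finset.mul_prod_erase Finset.univ _ (Finset.mem_univ i),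
      ← Finset.mul_prod_erase Finset.univ (fun j => ((m j)! : k)) (Finset.mem_univ i)]
    have : ∏ j ∈ Finset.univ.erase i, ((((Finsupp.single i 1 + m : σ →₀ ℕ) j)! : ℕ) : k) =
        ∏ j ∈ Finset.univ.erase i, ((m j)! : k) := by
      refine Finset.prod_congr rfl fun j hj => ?_
      simp [Finsupp.single_eq_of_ne (Finset.ne_of_mem_erase hj)]
    rw [this]
    simp only [Finsupp.add_apply, Finsupp.single_eq_same, add_comm 1, Nat.factorial_succ]
    push_cast
    ring
  exact LinearMap.congr_fun this P

theorem apolar_prod_X_mul {m : Type*} [Fintype m] [DecidableEq m] {l : ℕ} (i j : Fin l → m)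
    (Q P : MvPolynomial (m × m) k) :
    apolar k (m × m) Q ((∏ b, MvPolynomial.X (i b, j b)) * P) =
      apolar k (m × m)
        (iteratedDerivation (fun i j => MvPolynomial.pderiv (R := k) (i, j)) i j Q) P := by
  induction l generalizing P with
  | zero => simp [iteratedDerivation]
  | succ l ih =>
    -- The factor of index `0` must cross last, since `iteratedDerivation` applies its derivation
    -- outermost.
    rw [Fin.prod_univ_succ, mul_comm (MvPolynomial.X _), mul_assoc]
    refine (ih (Fin.tail i) (Fin.tail j) _).trans ?_
    rw [apolar_X_mul]
    rfl

/-- The apolar square norm of a power of the determinant. -/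
theorem apolar_det_pow [IsDomain k] (n s : ℕ) :
    apolar k (Fin n × Fin n) ((Matrix.mvPolynomialX (Fin n) (Fin n) k).det ^ s)
      ((Matrix.mvPolynomialX (Fin n) (Fin n) k).det ^ s) =
      ∏ t ∈ Finset.range s, ((t + 1).ascFactorial n : k) := by
  induction s with
  | zero =>
    have := apolar_monomial (k := k) (σ := Fin n × Fin n) 1 0
    simpa using this
  | succ s ih =>
    set D := (Matrix.mvPolynomialX (Fin n) (Fin n) k).det with hD
    -- One factor `D` is expanded into monomials, which cross the pairing as the differential
    -- operator of the Cayley identity.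
    have hexp : D ^ (s + 1) = ∑ e : Equiv.Perm (Fin n), ((Equiv.Perm.sign e : ℤ) : k) •
        ((∏ b, MvPolynomial.X (b, e b)) * D ^ s) := by
      have : D = ∑ e : Equiv.Perm (Fin n), ((Equiv.Perm.sign e : ℤ) : MvPolynomial _ k) *
          ∏ b, MvPolynomial.X (b, e b) := by
        rw [hD, ← Matrix.det_transpose, Matrix.det_apply']; rfl
      rw [pow_succ']
      nth_rewrite 1 [this]
      rw [Finset.sum_mul]
      refine Finset.sum_congr rfl fun e _ => ?_
      simp [mul_assoc, MvPolynomial.smul_eq_C_mul]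
    have hcayley := cayley_identity (k := k) n s
    rw [← hD] at hcayley
    calc apolar k (Fin n × Fin n) (D ^ (s + 1)) (D ^ (s + 1))
        = apolar k (Fin n × Fin n) (∑ e : Equiv.Perm (Fin n), ((Equiv.Perm.sign e : ℤ) : k) •
            iteratedDerivation (fun i j => MvPolynomial.pderiv (R := k) (i, j)) id e
              (D ^ (s + 1))) (D ^ s) := by
          nth_rewrite 2 [hexp]
          simp only [map_sum, map_smul, LinearMap.sum_apply, LinearMap.smul_apply]
          refine Finset.sum_congr rfl fun e _ => ?_
          rw [← apolar_prod_X_mul]; rfl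
      _ = apolar k (Fin n × Fin n) (((s + 1).ascFactorial n : k) • D ^ s) (D ^ s) := by
          congr 2
          refine Eq.trans ?_ (hcayley.trans ?_)
          · exact Finset.sum_congr rfl fun e _ => by simp [MvPolynomial.smul_eq_C_mul]
          · simp [MvPolynomial.smul_eq_C_mul]
      _ = _ := by
          rw [map_smul, LinearMap.smul_apply, ih, Finset.prod_range_succ, smul_eq_mul, mul_comm]

end Apolar

/-! ### Apolar pairing with symmetric sums of monomials. -/

/-- Two families have the same fiber sizes iff they differ by a permutation; the number of such
permutations. -/
theorem card_perm_comp_eq {P σ : Type*} [Fintype P] [DecidableEq P] [Fintype σ] [DecidableEq σ]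
    (u v : P → σ) :
    Fintype.card {ρ : Equiv.Perm P // u ∘ ρ = v} =
      if (∀ i, Fintype.card {p // u p = i} = Fintype.card {p // v p = i}) then
        ∏ i, (Fintype.card {p // u p = i})! else 0 := by
  split_ifs with h
  · let e : ∀ i, {p // v p = i} ≃ {p // u p = i} := fun i => Fintype.equivOfCardEq (h i).symm
    -- Matching the fibers gives one solution `ρ₀`; the others differ from it by the stabilizer of
    -- `u`.
    let ρ₀ : Equiv.Perm P := (Equiv.sigmaFiberEquiv v).symm.trans
      ((Equiv.sigmaCongrRight e).trans (Equiv.sigmaFiberEquiv u))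
    have hρ₀ : u ∘ ρ₀ = v := by
      ext p
      exact (e (v p) ⟨p, rfl⟩).2
    rw [← DomMulAct.stabilizer_card u]
    refine Fintype.card_congr
      { toFun := fun ρ => ⟨ρ.1 * ρ₀⁻¹, ?_⟩
        invFun := fun g => ⟨g.1 * ρ₀, ?_⟩
        left_inv := fun ρ => by simp
        right_inv := fun g => by simp }
    · rw [Equiv.Perm.coe_mul, ← Function.comp_assoc, ρ.2, ← hρ₀, Function.comp_assoc,
        ← Equiv.Perm.coe_mul, mul_inv_cancel]; rfl
    · rw [Equiv.Perm.coe_mul, ← Function.comp_assoc, g.2, hρ₀]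
  · rw [Fintype.card_eq_zero_iff]
    refine ⟨fun ρ => h fun i => ?_⟩
    refine Fintype.card_congr (ρ.1.symm.subtypeEquiv fun p => ?_)
    rw [← congrFun ρ.2 (ρ.1.symm p)]; simp

/-- Only the rearrangements `v` of `u` pair nontrivially. The square norm of their common monomial
is the number of `ρ` with `u ∘ ρ = v`, so the pairing is a sum of `F (u ∘ ρ)` over all permutations
`ρ`. -/
theorem apolar_sum_prod_X {k P σ : Type*} [CommRing k] [Fintype P] [DecidableEq P] [Fintype σ]
    [DecidableEq σ] (F : (P → σ) → k) (hF : ∀ v (ρ : Equiv.Perm P), F (v ∘ ρ) = F v)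
    (u : P → σ) :
    apolar k σ (∑ v, F v • ∏ p, MvPolynomial.X (v p)) (∏ p, MvPolynomial.X (u p)) =
      ((Fintype.card P)! : k) * F u := by
  have hmon : ∀ v : P → σ, (∏ p, MvPolynomial.X (v p) : MvPolynomial σ k) =
      MvPolynomial.monomial (∑ p, Finsupp.single (v p) 1) 1 := fun v => by
    rw [MvPolynomial.monomial_sum_one]; rfl
  have hcard : ∀ (v : P → σ) i, (∑ p, Finsupp.single (v p) 1 : σ →₀ ℕ) i =
      Fintype.card {p // v p = i} := fun v i => by
    rw [Finsupp.finsetSum_apply, Fintype.card_subtype, Finset.card_filter]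
    exact Finset.sum_congr rfl fun p _ => by rw [Finsupp.single_apply]
  have hN : ((Fintype.card P)! : k) * F u = ∑ ρ : Equiv.Perm P, F (u ∘ ρ) := by
    rw [Finset.sum_congr rfl fun ρ _ => hF u ρ, Finset.sum_const, Finset.card_univ,
      Fintype.card_perm, nsmul_eq_mul]
  rw [hN, hmon u, apolar_monomial, MvPolynomial.coeff_sum, Finset.mul_sum,
    ← Finset.sum_fiberwise_of_maps_to (s := Finset.univ) (t := Finset.univ)
      (g := fun ρ : Equiv.Perm P => u ∘ ρ) (fun _ _ => Finset.mem_univ _)]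
  refine Finset.sum_congr rfl fun v _ => ?_
  rw [Finset.sum_congr rfl (g := fun _ => F v) fun ρ hρ => by
    rw [(Finset.mem_filter.mp hρ).2], Finset.sum_const, ← Fintype.card_subtype,
    card_perm_comp_eq, hmon v, MvPolynomial.coeff_smul, MvPolynomial.coeff_monomial]
  have hiff : (∑ p, Finsupp.single (v p) 1 : σ →₀ ℕ) = ∑ p, Finsupp.single (u p) 1 ↔
      ∀ i, Fintype.card {p // u p = i} = Fintype.card {p // v p = i} := by
    rw [Finsupp.ext_iff]
    exact forall_congr' fun i => by rw [hcard, hcard, eq_comm]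
  by_cases h : ∀ i, Fintype.card {p // u p = i} = Fintype.card {p // v p = i}
  · rw [if_pos h, if_pos (hiff.mpr h)]
    simp only [hcard]
    simp
  · rw [if_neg h, if_neg (fun h' => h (hiff.mp h'))]
    simp

/-! ### The transfer matrix and its square. -/

section Kernel

/-- The transfer matrix of iterated matrix multiplication: the signed count of the permutations
of `Fin n × Fin n` with prescribed components. -/
noncomputable def transferMatrix (n : ℕ) :
    Matrix (Fin n × Fin n → Fin n) (Fin n × Fin n → Fin n) ℂ :=
  fun a b => ∑ σ : Equiv.Perm (Fin n × Fin n),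
    if Prod.fst ∘ σ = a ∧ Prod.snd ∘ σ = b then ((Equiv.Perm.sign σ : ℤ) : ℂ) else 0

theorem transferMatrix_pow_succ_apply (n m : ℕ) (a b : Fin n × Fin n → Fin n) :
    (transferMatrix n ^ (m + 1)) a b = ∑ σ : Fin (m + 1) → Equiv.Perm (Fin n × Fin n),
      (∏ k, ((Equiv.Perm.sign (σ k) : ℤ) : ℂ)) *
        ((∏ k : Fin m, if Prod.snd ∘ σ k.castSucc = Prod.fst ∘ σ k.succ then (1 : ℂ) else 0) *
          if Prod.fst ∘ σ 0 = a ∧ Prod.snd ∘ σ (Fin.last m) = b then 1 else 0) := by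
  induction m generalizing a with
  | zero =>
    rw [pow_one, transferMatrix, ← Equiv.sum_comp (Equiv.funUnique (Fin 1) _).symm]
    refine Finset.sum_congr rfl fun σ _ => ?_
    simp
  | succ m ih =>
    rw [pow_succ', Matrix.mul_apply, ← Equiv.sum_comp (Fin.consEquiv fun _ => _),
      Fintype.sum_prod_type]
    simp only [ih, transferMatrix, Finset.sum_mul]
    rw [Finset.sum_comm]
    refine Finset.sum_congr rfl fun τ _ => ?_
    simp only [Finset.mul_sum]
    rw [Finset.sum_comm]
    refine Finset.sum_congr rfl fun σ _ => ?_
    simp only [Fin.consEquiv, Equiv.coe_fn_mk]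
    conv_rhs => rw [Fin.prod_univ_succ (n := m), Fin.prod_univ_succ (n := m + 1)]
    simp only [Fin.cons_zero, Fin.cons_succ, Fin.castSucc_zero, ← Fin.succ_castSucc,
      ← Fin.succ_last]
    -- The intermediate index of the matrix product is forced to be the second component of the
    -- first permutation.
    rw [Finset.sum_eq_single (Prod.snd ∘ τ)]
    · rw [if_congr (eq_comm (a := Prod.snd ∘ τ) (b := Prod.fst ∘ σ 0)) rfl rfl]
      by_cases h1 : Prod.fst ∘ τ = a
      · by_cases h2 : Prod.fst ∘ σ 0 = Prod.snd ∘ τ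
        · simp only [h1, h2, true_and, and_true, if_true, one_mul, mul_assoc]
        · simp only [h2, false_and, if_false, zero_mul, mul_zero]
      · simp only [h1, false_and, if_false, zero_mul, mul_zero]
    · intro c _ hc
      rw [if_neg (fun h => hc h.2.symm), zero_mul]
    · simp

/-- The hyperdeterminant of the matrix multiplication tensor is a normalized trace of a power of
the transfer matrix. -/
theorem hyperdet_matMulTensor_eq_trace (m : ℕ) (hd : 0 < m + 1) (n : ℕ) :
    hyperdet (matMulTensor (m + 1) hd n) =
      1 / ((Fintype.card (Fin n × Fin n))! : ℂ) * (transferMatrix n ^ (m + 1)).trace := by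
  rw [hyperdet, Matrix.trace]
  congr 1
  simp only [Matrix.diag_apply, transferMatrix_pow_succ_apply]
  rw [Finset.sum_comm]
  refine Finset.sum_congr rfl fun σ _ => ?_
  rw [← Finset.mul_sum, ← Finset.mul_sum]
  congr 1
  have hb : ∀ f g : Fin n × Fin n → Fin n,
      ∏ p, (if f p = g p then (1 : ℂ) else 0) = if f = g then 1 else 0 := fun f g => by
    rw [Fintype.prod_boole]
    simp only [funext_iff]
  simp only [matMulTensor, shiftedMatMulTensor, Matrix.one_apply, Finset.prod_mul_distrib]
  congr 1
  · rw [Finset.prod_comm]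
    exact Finset.prod_congr rfl fun k _ => hb (fun p => (σ k.castSucc p).2)
      (fun p => (σ k.succ p).1)
  · refine (hb (fun p => (σ 0 p).1) (fun p => (σ (Fin.last m) p).2)).trans ?_
    rw [Finset.sum_eq_single (Prod.fst ∘ σ 0)]
    · refine if_congr ?_ rfl rfl
      exact ⟨fun h => ⟨rfl, h.symm⟩, fun h => h.2.symm⟩
    · intro c _ hc
      rw [if_neg (fun h => hc h.1.symm)]
    · simp

/-- The sign of the coordinate swap on `Fin n × Fin n`. -/
noncomputable def swapSign (n : ℕ) : ℂ :=
  ((Equiv.Perm.sign (Equiv.prodComm (Fin n) (Fin n)) : ℤ) : ℂ)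

theorem swapSign_eq (n : ℕ) : swapSign n = 1 ∨ swapSign n = -1 := by
  rcases Int.units_eq_one_or (Equiv.Perm.sign (Equiv.prodComm (Fin n) (Fin n))) with h | h <;>
    simp [swapSign, h]

theorem swapSign_mul_self (n : ℕ) : swapSign n * swapSign n = 1 := by
  rcases swapSign_eq n with h | h <;> simp [h]

theorem transferMatrix_swap (n : ℕ) (a b : Fin n × Fin n → Fin n) :
    transferMatrix n b a = swapSign n * transferMatrix n a b := by
  rw [transferMatrix, transferMatrix, Finset.mul_sum,
    ← Equiv.sum_comp (Equiv.mulLeft (Equiv.prodComm (Fin n) (Fin n) : Equiv.Perm _))]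
  refine Finset.sum_congr rfl fun σ _ => ?_
  rw [mul_ite, mul_zero]
  refine if_congr ?_ ?_ rfl
  · exact and_comm
  · simp [swapSign]

theorem transferMatrix_comp_perm (n : ℕ) (a b : Fin n × Fin n → Fin n)
    (ρ : Equiv.Perm (Fin n × Fin n)) :
    transferMatrix n (a ∘ ρ) (b ∘ ρ) = ((Equiv.Perm.sign ρ : ℤ) : ℂ) * transferMatrix n a b := by
  rw [transferMatrix, transferMatrix, Finset.mul_sum, ← Equiv.sum_comp (Equiv.mulRight ρ)]
  refine Finset.sum_congr rfl fun σ _ => ?_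
  rw [mul_ite, mul_zero]
  refine if_congr ?_ ?_ rfl
  · simp only [Equiv.coe_mulRight, Equiv.Perm.coe_mul, ← Function.comp_assoc,
      ρ.surjective.injective_comp_right.eq_iff]
  · simp [mul_comm]

/-- The two signs of `ρ` cancel. This invariance is what `apolar_sum_prod_X` requires of its
coefficients. -/
theorem transferMatrix_sq_comp_perm (n : ℕ) (a b : Fin n × Fin n → Fin n)
    (ρ : Equiv.Perm (Fin n × Fin n)) :
    (transferMatrix n ^ 2) (a ∘ ρ) (b ∘ ρ) = (transferMatrix n ^ 2) a b := by
  rw [pow_two, Matrix.mul_apply, Matrix.mul_apply,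
    ← Equiv.sum_comp (Equiv.arrowCongr ρ.symm (Equiv.refl (Fin n)))]
  refine Finset.sum_congr rfl fun c _ => ?_
  have : (Equiv.arrowCongr ρ.symm (Equiv.refl (Fin n))) c = c ∘ ρ := by ext; simp
  rw [this, transferMatrix_comp_perm, transferMatrix_comp_perm, mul_mul_mul_comm]
  rcases Int.units_eq_one_or (Equiv.Perm.sign ρ) with h | h <;> simp [h]

/-- The symmetric Leibniz formula for the determinant. -/
theorem card_factorial_mul_det {R ι : Type*} [CommRing R] [Fintype ι] [DecidableEq ι]
    (M : Matrix ι ι R) :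
    ((Fintype.card ι)! : R) * M.det = ∑ σ : Equiv.Perm ι, ∑ τ : Equiv.Perm ι,
      (((Equiv.Perm.sign σ : ℤ) : R) * ((Equiv.Perm.sign τ : ℤ) : R)) *
        ∏ p, M (σ p) (τ p) := by
  have h : ∀ τ : Equiv.Perm ι, ∑ σ : Equiv.Perm ι,
      (((Equiv.Perm.sign σ : ℤ) : R) * ((Equiv.Perm.sign τ : ℤ) : R)) *
        ∏ p, M (σ p) (τ p) = M.det := fun τ => by
    have hp := Matrix.det_permute' τ M
    rw [Matrix.det_apply'] at hp
    simp only [Matrix.submatrix_apply, id] at hp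
    have hs : ((Equiv.Perm.sign τ : ℤ) : R) * ((Equiv.Perm.sign τ : ℤ) : R) = 1 := by
      rcases Int.units_eq_one_or (Equiv.Perm.sign τ) with h | h <;> simp [h]
    calc _ = ((Equiv.Perm.sign τ : ℤ) : R) * ∑ σ : Equiv.Perm ι, ((Equiv.Perm.sign σ : ℤ) : R) *
          ∏ p, M (σ p) (τ p) := by
          rw [Finset.mul_sum]
          exact Finset.sum_congr rfl fun σ _ => by ring
      _ = M.det := by rw [hp, ← mul_assoc, hs, one_mul]
  rw [Finset.sum_comm, Finset.sum_congr rfl fun τ _ => h τ, Finset.sum_const, Finset.card_univ,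
    Fintype.card_perm, nsmul_eq_mul]

/-- In the symmetric Leibniz formula for `n` diagonal copies of `Z`, a pair `σ, τ` survives exactly
when the second components agree, which is the condition for it to contribute to an entry of `T Tᵀ`.
-/
theorem sum_transferMatrix_sq_smul_prod {R : Type*} [CommRing R] [Algebra ℂ R] (n : ℕ)
    (Z : Matrix (Fin n) (Fin n) R) :
    ∑ a, ∑ b, (transferMatrix n ^ 2) a b • ∏ p, Z (a p) (b p) =
      (swapSign n * ((Fintype.card (Fin n × Fin n))! : ℂ)) • Z.det ^ n := by
  have hdet : Z.det ^ n = (Matrix.blockDiagonal fun _ : Fin n => Z).det := by simp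
  have hprod : ∀ σ τ : Equiv.Perm (Fin n × Fin n),
      ∏ p, Matrix.blockDiagonal (fun _ : Fin n => Z) (σ p) (τ p) =
        if Prod.snd ∘ σ = Prod.snd ∘ τ then ∏ p, Z (σ p).1 (τ p).1 else 0 := fun σ τ => by
    simp only [Matrix.blockDiagonal_apply, funext_iff, Function.comp_apply]
    rw [Finset.prod_ite_zero]
    simp
  have hL : ∀ a b, (transferMatrix n ^ 2) a b = swapSign n *
      ∑ c, transferMatrix n a c * transferMatrix n b c := fun a b => by
    rw [pow_two, Matrix.mul_apply, Finset.mul_sum]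
    exact Finset.sum_congr rfl fun c _ => by rw [transferMatrix_swap n b c]; ring
  have hmain : ∑ a, ∑ b, (∑ c, transferMatrix n a c * transferMatrix n b c) •
      ∏ p, Z (a p) (b p) = ((Fintype.card (Fin n × Fin n))! : R) * Z.det ^ n := by
    rw [hdet, card_factorial_mul_det]
    simp only [hprod]
    have hc : ∀ a b, (∑ c, transferMatrix n a c * transferMatrix n b c) =
        ∑ σ : Equiv.Perm (Fin n × Fin n), ∑ τ : Equiv.Perm (Fin n × Fin n),
          if Prod.fst ∘ σ = a ∧ Prod.fst ∘ τ = b ∧ Prod.snd ∘ σ = Prod.snd ∘ τ then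
            ((Equiv.Perm.sign σ : ℤ) : ℂ) * ((Equiv.Perm.sign τ : ℤ) : ℂ) else 0 := fun a b => by
      simp only [transferMatrix, Finset.sum_mul_sum]
      rw [Finset.sum_comm]
      refine Finset.sum_congr rfl fun σ _ => ?_
      rw [Finset.sum_comm]
      refine Finset.sum_congr rfl fun τ _ => ?_
      rw [Finset.sum_eq_single (Prod.snd ∘ σ)]
      · by_cases h1 : Prod.fst ∘ σ = a <;> by_cases h2 : Prod.fst ∘ τ = b <;>
          simp [h1, h2, eq_comm]
      · intro c _ hc
        rw [if_neg (fun h => hc h.2.symm), zero_mul]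
      · simp
    simp only [hc, Finset.sum_smul]
    have swap4 : ∀ f : (Fin n × Fin n → Fin n) → (Fin n × Fin n → Fin n) →
        Equiv.Perm (Fin n × Fin n) → Equiv.Perm (Fin n × Fin n) → R,
        ∑ a, ∑ b, ∑ σ, ∑ τ, f a b σ τ = ∑ σ, ∑ τ, ∑ a, ∑ b, f a b σ τ := fun f => by
      simp_rw [← Fintype.sum_prod_type' (f := fun σ τ => f _ _ σ τ)]
      simp_rw [← Fintype.sum_prod_type' (f := fun a b => ∑ x : _ × _, f a b x.1 x.2)]
      rw [Finset.sum_comm]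
      simp_rw [Fintype.sum_prod_type]
    rw [swap4]
    refine Finset.sum_congr rfl fun σ _ => Finset.sum_congr rfl fun τ _ => ?_
    rw [Finset.sum_eq_single (Prod.fst ∘ σ), Finset.sum_eq_single (Prod.fst ∘ τ)]
    · by_cases h : Prod.snd ∘ σ = Prod.snd ∘ τ
      · simp [h, Algebra.smul_def]
      · simp [h]
    · intro b _ hb
      rw [if_neg (fun h => hb h.2.1.symm), zero_smul]
    · simp
    · intro a _ ha
      refine Finset.sum_eq_zero fun b _ => ?_
      rw [if_neg (fun h => ha h.1.symm), zero_smul]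
    · simp
  simp only [hL, mul_smul, ← Finset.smul_sum, hmain]
  congr 1
  rw [Algebra.smul_def, map_natCast]

end Kernel

/-! ### Recursion over the even powers of the transfer matrix. -/

section Recursion

/-- A family of polynomial identities between complex matrices holds over every `ℂ`-algebra. -/
theorem sum_smul_prod_eq_smul_det_pow_of_complex {n e : ℕ} {P R : Type*} [Fintype P]
    [DecidableEq P] [CommRing R] [Algebra ℂ R] (F : (P → Fin n) → (P → Fin n) → ℂ) (c : ℂ)
    (h : ∀ Y : Matrix (Fin n) (Fin n) ℂ,
      ∑ a, ∑ b, F a b * ∏ p, Y (a p) (b p) = c * Y.det ^ e) (Y : Matrix (Fin n) (Fin n) R) :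
    ∑ a, ∑ b, F a b • ∏ p, Y (a p) (b p) = c • Y.det ^ e := by
  have hgen : ∑ a, ∑ b, F a b • ∏ p, Matrix.mvPolynomialX (Fin n) (Fin n) ℂ (a p) (b p) =
      c • (Matrix.mvPolynomialX (Fin n) (Fin n) ℂ).det ^ e := by
    -- Over the infinite field `ℂ`, values determine the polynomial; the generic identity then
    -- specializes to any algebra.
    refine MvPolynomial.funext fun x => ?_
    have hdet : MvPolynomial.eval x (Matrix.mvPolynomialX (Fin n) (Fin n) ℂ).det =
        (Matrix.of fun i j => x (i, j)).det := by
      rw [RingHom.map_det]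
      congr 1
      ext i j
      simp
    have := h (Matrix.of fun i j => x (i, j))
    rw [← hdet] at this
    simpa using this
  have hdet : MvPolynomial.aeval (fun p : Fin n × Fin n => Y p.1 p.2)
      (Matrix.mvPolynomialX (Fin n) (Fin n) ℂ).det = Y.det := by
    rw [AlgHom.map_det]
    congr 1
    ext i j
    simp
  have := congrArg (MvPolynomial.aeval (fun p : Fin n × Fin n => Y p.1 p.2)) hgen
  simpa only [map_sum, map_smul, map_prod, Matrix.mvPolynomialX_apply, MvPolynomial.aeval_X,
    map_pow, hdet] using this

/-- The entries of the squared transfer matrix are apolar pairings with `det ^ n`. -/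
theorem apolar_det_pow_prod_X (n : ℕ) (a b : Fin n × Fin n → Fin n) :
    apolar ℂ (Fin n × Fin n) ((Matrix.mvPolynomialX (Fin n) (Fin n) ℂ).det ^ n)
      (∏ p, MvPolynomial.X (a p, b p)) = swapSign n * (transferMatrix n ^ 2) a b := by
  have hN : ((Fintype.card (Fin n × Fin n))! : ℂ) ≠ 0 := by
    exact_mod_cast Nat.factorial_ne_zero _
  let F : (Fin n × Fin n → Fin n × Fin n) → ℂ := fun v =>
    (transferMatrix n ^ 2) (Prod.fst ∘ v) (Prod.snd ∘ v)
  have hsum : ∑ v, F v • ∏ p, (MvPolynomial.X (v p) : MvPolynomial (Fin n × Fin n) ℂ) =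
      (swapSign n * ((Fintype.card (Fin n × Fin n))! : ℂ)) •
        (Matrix.mvPolynomialX (Fin n) (Fin n) ℂ).det ^ n := by
    rw [← sum_transferMatrix_sq_smul_prod, ← Equiv.sum_comp (Equiv.arrowProdEquivProdArrow
      (Fin n × Fin n) (fun _ => Fin n) (fun _ => Fin n)).symm, Fintype.sum_prod_type]
    rfl
  have hinv : ∀ v (ρ : Equiv.Perm (Fin n × Fin n)), F (v ∘ ρ) = F v := fun v ρ =>
    transferMatrix_sq_comp_perm n (Prod.fst ∘ v) (Prod.snd ∘ v) ρ
  have h3 := apolar_sum_prod_X F hinv (fun p => (a p, b p))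
  have hF : F (fun p => (a p, b p)) = (transferMatrix n ^ 2) a b := rfl
  rw [hsum, hF] at h3
  rw [map_smul, LinearMap.smul_apply, smul_eq_mul, mul_comm (swapSign n), mul_assoc] at h3
  rw [← mul_left_cancel₀ hN h3, ← mul_assoc, swapSign_mul_self, one_mul]

theorem sum_transferMatrix_pow_mul_prod (n t : ℕ) (Y : Matrix (Fin n) (Fin n) ℂ) :
    ∑ a, ∑ b, (transferMatrix n ^ (2 * t + 2)) a b * ∏ p, Y (a p) (b p) =
      (swapSign n * ((Fintype.card (Fin n × Fin n))! : ℂ) *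
        (swapSign n * ∏ s ∈ Finset.range n, ((s + 1).ascFactorial n : ℂ)) ^ t) * Y.det ^ n := by
  induction t generalizing Y with
  | zero => simpa using sum_transferMatrix_sq_smul_prod n Y
  | succ t ih =>
    set c := swapSign n * ((Fintype.card (Fin n × Fin n))! : ℂ) *
        (swapSign n * ∏ s ∈ Finset.range n, ((s + 1).ascFactorial n : ℂ)) ^ t
    set Z := Matrix.mvPolynomialX (Fin n) (Fin n) ℂ with hZ
    -- Transposing `Z` produces the monomials `X (b p, g p)`, whose pairing with `det ^ n` is the
    -- entry of `T ^ 2` at `(b, g)` up to sign: the next matrix factor.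
    have hYZ := sum_smul_prod_eq_smul_det_pow_of_complex _ c ih
      (Y.map (MvPolynomial.C : ℂ →+* MvPolynomial (Fin n × Fin n) ℂ) * Z.transpose)
    have hdet : (Y.map (MvPolynomial.C : ℂ →+* MvPolynomial (Fin n × Fin n) ℂ) *
        Z.transpose).det ^ n = (Y.det ^ n) • Z.det ^ n := by
      rw [Matrix.det_mul, Matrix.det_transpose, mul_pow, MvPolynomial.smul_eq_C_mul, map_pow]
      congr 2
      exact (RingHom.map_det _ _).symm
    have hprod : ∀ a b : Fin n × Fin n → Fin n,
        ∏ p, (Y.map (MvPolynomial.C : ℂ →+* MvPolynomial (Fin n × Fin n) ℂ) *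
          Z.transpose) (a p) (b p) =
        ∑ g : Fin n × Fin n → Fin n, (∏ p, Y (a p) (g p)) •
          ∏ p, MvPolynomial.X (b p, g p) := fun a b => by
      simp only [Matrix.mul_apply]
      rw [Finset.prod_univ_sum, Fintype.piFinset_univ]
      refine Finset.sum_congr rfl fun g _ => ?_
      rw [Finset.prod_mul_distrib, MvPolynomial.smul_eq_C_mul, map_prod]
      rfl
    rw [hdet] at hYZ
    simp only [hprod] at hYZ
    have hL := congrArg (apolar ℂ (Fin n × Fin n) (Z.det ^ n)) hYZ
    simp only [map_sum, map_smul, smul_eq_mul, hZ, apolar_det_pow_prod_X, apolar_det_pow] at hL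
    have hε := swapSign_mul_self n
    calc _ = swapSign n * ∑ a, ∑ b, (transferMatrix n ^ (2 * t + 2)) a b *
          ∑ g : Fin n × Fin n → Fin n, (∏ p, Y (a p) (g p)) *
            (swapSign n * (transferMatrix n ^ 2) b g) := by
          rw [Finset.mul_sum]
          refine Finset.sum_congr rfl fun a _ => ?_
          simp only [Finset.mul_sum]
          rw [Finset.sum_comm]
          refine Finset.sum_congr rfl fun g _ => ?_
          rw [show 2 * (t + 1) + 2 = (2 * t + 2) + 2 by ring, pow_add _ _ 2, Matrix.mul_apply,
            Finset.sum_mul]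
          refine Finset.sum_congr rfl fun b _ => ?_
          linear_combination (-(transferMatrix n ^ (2 * t + 2)) a b *
            (transferMatrix n ^ 2) b g * ∏ p, Y (a p) (g p)) * hε
      _ = _ := by
          rw [hL, pow_succ]
          ring

/-- The hyperdeterminant of the matrix multiplication tensor, with its sign. -/
theorem hyperdet_matMulTensor (t n : ℕ) (hd : 0 < 2 * t + 2) :
    hyperdet (matMulTensor (2 * t + 2) hd n) =
      swapSign n * (swapSign n * ∏ s ∈ Finset.range n, ((s + 1).ascFactorial n : ℂ)) ^ t := by
  have hN : ((Fintype.card (Fin n × Fin n))! : ℂ) ≠ 0 := by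
    exact_mod_cast Nat.factorial_ne_zero _
  have h := sum_transferMatrix_pow_mul_prod n t 1
  -- At the identity matrix the product is the indicator of `a = b`.
  have htr : (transferMatrix n ^ (2 * t + 2)).trace = ∑ a, ∑ b,
      (transferMatrix n ^ (2 * t + 2)) a b *
        ∏ p, (1 : Matrix (Fin n) (Fin n) ℂ) (a p) (b p) := by
    refine Finset.sum_congr rfl fun a _ => ?_
    simp only [Matrix.one_apply, Fintype.prod_boole, ← funext_iff]
    simp
  rw [hyperdet_matMulTensor_eq_trace (2 * t + 1) hd n, htr, h, Matrix.det_one, one_pow, mul_one]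
  field_simp

/-! ### Factorial quotients, hook lengths and the final sign. -/

theorem prod_ascFactorial_eq (n : ℕ) :
    ∏ s ∈ Finset.range n, ((s + 1).ascFactorial n : ℂ) =
      ∏ i ∈ Finset.range n, (((n + i)! : ℂ) / (i ! : ℂ)) := by
  refine Finset.prod_congr rfl fun i _ => ?_
  rw [eq_div_iff (by exact_mod_cast Nat.factorial_ne_zero i), mul_comm, add_comm n i]
  exact_mod_cast Nat.factorial_mul_ascFactorial i n

theorem hookLength_squareDiagram {n a b : ℕ} (ha : a < n) (hb : b < n) :
    hookLength (squareDiagram n) (a, b) = (n - 1 - a) + (n - b) := by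
  -- The hook is the leg strictly below the cell together with the arm that includes the cell, so
  -- the cell is counted once.
  have h : ((squareDiagram n).cells.filter fun e : ℕ × ℕ =>
      (e.1 = a ∧ b ≤ e.2) ∨ (e.2 = b ∧ a ≤ e.1)) =
      (Finset.Ico (a + 1) n ×ˢ {b}) ∪ ({a} ×ˢ Finset.Ico b n) := by
    ext ⟨x, y⟩
    simp only [squareDiagram, Finset.mem_filter, Finset.mem_product, Finset.mem_range,
      Finset.mem_union, Finset.mem_Ico, Finset.mem_singleton]
    omega
  rw [hookLength, h, Finset.card_union_of_disjoint]
  · simp; omega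
  · rw [Finset.disjoint_left]
    rintro ⟨x, y⟩ h1 h2
    simp only [Finset.mem_product, Finset.mem_Ico, Finset.mem_singleton] at h1 h2
    omega

theorem hookProduct_squareDiagram (n : ℕ) :
    hookProduct (squareDiagram n) = ∏ s ∈ Finset.range n, (s + 1).ascFactorial n := by
  have h : hookProduct (squareDiagram n) =
      ∏ a ∈ Finset.range n, ∏ b ∈ Finset.range n, ((n - 1 - a) + (n - b)) := by
    rw [hookProduct, ← Finset.prod_product']
    refine Finset.prod_congr rfl fun c hc => ?_
    obtain ⟨ha, hb⟩ := Finset.mem_product.mp hc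
    exact hookLength_squareDiagram (Finset.mem_range.mp ha) (Finset.mem_range.mp hb)
  -- After reflecting rows and columns the hook lengths are `s + 1 + b`, the factors of the rising
  -- factorial.
  rw [h, Finset.prod_range_reflect (fun a => ∏ b ∈ Finset.range n, (a + (n - b))) n]
  refine Finset.prod_congr rfl fun s _ => ?_
  rw [← Finset.prod_range_reflect, Nat.ascFactorial_eq_prod_range]
  refine Finset.prod_congr rfl fun b hb => ?_
  have := Finset.mem_range.mp hb
  omega

end Recursion

theorem theorem1p3 (d : ℕ) (hd : 0 < d) (hde : Even d) (n : ℕ) :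
    (hyperdet (matMulTensor d hd n)
        = (∏ i ∈ Finset.range n, (((n + i)! : ℂ) / (i ! : ℂ))) ^ (d / 2 - 1) ∨
      hyperdet (matMulTensor d hd n)
        = -(∏ i ∈ Finset.range n, (((n + i)! : ℂ) / (i ! : ℂ))) ^ (d / 2 - 1)) ∧
    (∏ i ∈ Finset.range n, (((n + i)! : ℂ) / (i ! : ℂ)))
        = (hookProduct (squareDiagram n) : ℂ) ∧
    hyperdet (matMulTensor d hd n) ≠ 0 := by
  obtain ⟨t, rfl⟩ : ∃ t, d = 2 * t + 2 := by
    obtain ⟨r, hr⟩ := hde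
    -- Positivity of `d` gives `r ≥ 1`, so the truncated subtraction is exact.
    exact ⟨r - 1, by omega⟩
  have ht : (2 * t + 2) / 2 - 1 = t := by omega
  have hne : ∏ i ∈ Finset.range n, (((n + i)! : ℂ) / (i ! : ℂ)) ≠ 0 :=
    Finset.prod_ne_zero_iff.mpr fun i _ => div_ne_zero
      (by exact_mod_cast Nat.factorial_ne_zero _) (by exact_mod_cast Nat.factorial_ne_zero _)
  have hval := hyperdet_matMulTensor t n hd
  rw [prod_ascFactorial_eq, mul_pow, ← mul_assoc, ← pow_succ'] at hval
  rw [ht]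
  have hsign : swapSign n ^ (t + 1) = 1 ∨ swapSign n ^ (t + 1) = -1 := by
    rcases swapSign_eq n with h | h
    · simp [h]
    · rw [h]; exact neg_one_pow_eq_or ℂ _
  have hor : hyperdet (matMulTensor (2 * t + 2) hd n)
        = (∏ i ∈ Finset.range n, (((n + i)! : ℂ) / (i ! : ℂ))) ^ t ∨
      hyperdet (matMulTensor (2 * t + 2) hd n)
        = -(∏ i ∈ Finset.range n, (((n + i)! : ℂ) / (i ! : ℂ))) ^ t := by
    rcases hsign with h | h
    · left; rw [hval, h, one_mul]
    · right; rw [hval, h, neg_one_mul]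
  refine ⟨hor, ?_, ?_⟩
  · rw [← prod_ascFactorial_eq, hookProduct_squareDiagram, Nat.cast_prod]
  · rcases hor with h | h
    · rw [h]; exact pow_ne_zero _ hne
    · rw [h]; exact neg_ne_zero.mpr (pow_ne_zero _ hne)
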